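/- Let $\Gamma_1$ and $\Gamma_2$ be groups with a common subgroup $\Lambda$ such that $[\Gamma_1:\Lambda]\geq 2$ and $[\Gamma_2:\Lambda]\geq 3$ (infinite indices are allowed), and let $\Gamma=\Gamma_1*_\Lambda\Gamma_2$ be the amalgamated free product. Assume that there are finitely many elements $g_1,\dots,g_m\in\Gamma$ with $\bigcap_{i=1}^m g_i\Lambda g_i^{-1}=\{e\}$. Let $L(\Gamma)\subset\mathbb B(\ell^2(\Gamma))$ be the von Neumann algebra generated by the left regular representation of $\Gamma$, let $\tau(x)=\langle x\delta_e,\delta_e\rangle$ be its canonical trace, and write $\|x\|_2=\tau(x^*x)^{1/2}$. Then: 1. $L(\Gamma)$ is a II$_1$ factor, i.e. an infinite dimensional factor on which $\tau$ is a faithful normal tracial state. 2. $L(\Gamma)$ does not have property $\Gamma$ of Murray and von Neumann: there is no sequence of unitaries $u_n\in L(\Gamma)$ with $\tau(u_n)=0$ for all $n$ and $\|u_nx-xu_n\|_2\to 0$ for every $x\in L(\Gamma)$. 3. $\Gamma$ is not inner amenable: the unitary representation $\pi$ of $\Gamma$ on $\ell^2(\Gamma\setminus\{e\})$ given by $\pi(g)\delta_h=\delta_{ghg^{-1}}$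 does not have almost invariant vectors, i.e. it is not the case that for every finite $F\subset\Gamma$ and every $\varepsilon>0$ there is a unit vector $\xi$ with $\|\pi(g)\xi-\xi\|<\varepsilon$ for all $g\in F$. -/

import Mathlib

open scoped lp ComplexOrder
open Filter Topology

noncomputable section

namespace GroupVN

universe u

/-! ### Unitary representations on `ℓ²` coming from permutations -/

/-- The unitary operator of `ℓ²(X)` induced by a permutation `σ` of `X`,
`(permUnitary σ f)(x) = f (σ⁻¹ x)`. It maps `δ_x` to `δ_{σ x}`. -/
def permUnitary {X : Type u} (σ : Equiv.Perm X) : ℓ²(X, ℂ) ≃ₗᵢ[ℂ] ℓ²(X, ℂ) where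
  toFun f := ⟨fun x => f (σ.symm x), memℓp_gen (by
    have h := (lp.memℓp f).summable (by simp)
    exact (Equiv.summable_iff (f := fun i => ‖f i‖ ^ (2 : ENNReal).toReal) σ.symm).2 h)⟩
  invFun f := ⟨fun x => f (σ x), memℓp_gen (by
    have h := (lp.memℓp f).summable (by simp)
    exact (Equiv.summable_iff (f := fun i => ‖f i‖ ^ (2 : ENNReal).toReal) σ).2 h)⟩
  map_add' _ _ := rfl
  map_smul' _ _ := rfl
  left_inv f := by ext x; simp
  right_inv f := by ext x; simp
  norm_map' f := by
    rw [lp.norm_eq_tsum_rpow (by simp), lp.norm_eq_tsum_rpow (by simp)]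
    congr 1
    exact Equiv.tsum_eq σ.symm (fun i => ‖f i‖ ^ (2 : ENNReal).toReal)

theorem permUnitary_apply {X : Type u} (σ : Equiv.Perm X) (f : ℓ²(X, ℂ)) (x : X) :
    permUnitary σ f x = f (σ.symm x) := rfl

/-- The basis vector `δ_x` of `ℓ²(X)`. -/
def delta {X : Type u} (x : X) : ℓ²(X, ℂ) :=
  letI := Classical.decEq X
  lp.single 2 x (1 : ℂ)

theorem permUnitary_delta {X : Type u} (σ : Equiv.Perm X) (x : X) :
    permUnitary σ (delta x) = delta (σ x) := by
  classical
  ext y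
  rw [permUnitary_apply]
  simp only [delta, lp.single_apply, Pi.single_apply, Equiv.symm_apply_eq]

/-- The unitary representation of `G` on `ℓ²(X)` attached to an action of `G` on `X` by
permutations. -/
def permRep {G X : Type u} [Group G] (α : G →* Equiv.Perm X) :
    G →* (ℓ²(X, ℂ) ≃ₗᵢ[ℂ] ℓ²(X, ℂ)) where
  toFun g := permUnitary (α g)
  map_one' := by
    rw [map_one]; rfl
  map_mul' g h := by
    rw [map_mul]; rfl

/-- The left regular representation of `G` on `ℓ²(G)`: `g ↦ (δ_h ↦ δ_{gh})`. -/
def leftRegular (G : Type u) [Group G] : G →* (ℓ²(G, ℂ) ≃ₗᵢ[ℂ] ℓ²(G, ℂ)) :=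
  permRep (MulAction.toPermHom G G)

/-- The conjugation action of `G` on `G ∖ {e}`. -/
def conjPerm (G : Type u) [Group G] : G →* Equiv.Perm {h : G // h ≠ 1} where
  toFun g :=
    { toFun := fun h => ⟨g * h.1 * g⁻¹, by simpa using h.2⟩
      invFun := fun h => ⟨g⁻¹ * h.1 * g, by
        have := (conj_eq_one_iff (a := g⁻¹) (b := h.1)).not.2 h.2
        simpa using this⟩
      left_inv := fun h => by ext; simp [mul_assoc]
      right_inv := fun h => by ext; simp [mul_assoc] }
  map_one' := by ext h; simp
  map_mul' g k := by ext h; simp [mul_assoc]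

/-- The representation `π` of `G` on `ℓ²(G ∖ {e})` with `π(g) δ_h = δ_{g h g⁻¹}`. -/
def conjRep (G : Type u) [Group G] :
    G →* (ℓ²({h : G // h ≠ 1}, ℂ) ≃ₗᵢ[ℂ] ℓ²({h : G // h ≠ 1}, ℂ)) :=
  permRep (conjPerm G)

/-- A unitary representation has almost invariant vectors if for every finite set `F ⊆ G` and
every `ε > 0` there is a unit vector moved by less than `ε` by each element of `F`. -/
def HasAlmostInvariantVectors {G H : Type*} [Group G] [NormedAddCommGroup H]
    [InnerProductSpace ℂ H] (π : G →* (H ≃ₗᵢ[ℂ] H)) : Prop :=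
  ∀ (F : Finset G) (ε : ℝ), 0 < ε → ∃ ξ : H, ‖ξ‖ = 1 ∧ ∀ g ∈ F, ‖π g ξ - ξ‖ < ε

/-- `G` is inner amenable if the conjugation representation on `ℓ²(G ∖ {e})` has almost
invariant vectors. -/
def InnerAmenable (G : Type u) [Group G] : Prop :=
  HasAlmostInvariantVectors (conjRep G)

/-! ### Tracial von Neumann algebras, II₁ factors, property Gamma -/

section VN

variable {H : Type u} [NormedAddCommGroup H] [InnerProductSpace ℂ H] [CompleteSpace H]

/-- The von Neumann algebra generated by a set `S` of operators: the bicommutant of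
`S ∪ S*`. -/
def generated (S : Set (H →L[ℂ] H)) : VonNeumannAlgebra H where
  toStarSubalgebra := StarSubalgebra.centralizer ℂ (StarSubalgebra.centralizer ℂ S : Set (H →L[ℂ] H))
  centralizer_centralizer' := by simp

/-- `τ` is a faithful normal tracial state on `M`. Normality is `σ`-weak continuity, i.e. `τ` has
the form `x ↦ ∑ₙ ⟨x ξₙ, ηₙ⟩` with `∑ ‖ξₙ‖² < ∞` and `∑ ‖ηₙ‖² < ∞`
(Mathlib's inner product is linear in the second variable). -/
structure IsFaithfulNormalTracialState (M : VonNeumannAlgebra H)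
    (τ : M.toStarSubalgebra →ₗ[ℂ] ℂ) : Prop where
  map_one : τ 1 = 1
  nonneg : ∀ x, 0 ≤ τ (star x * x)
  faithful : ∀ x, τ (star x * x) = 0 → x = 0
  tracial : ∀ x y, τ (x * y) = τ (y * x)
  normal : ∃ ξ η : ℕ → H, Summable (fun n => ‖ξ n‖ ^ 2) ∧ Summable (fun n => ‖η n‖ ^ 2) ∧
    ∀ x : M.toStarSubalgebra, HasSum (fun n => inner ℂ (η n) ((x : H →L[ℂ] H) (ξ n))) (τ x)

/-- `M` is a factor: its center consists of the scalars. -/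
def IsFactor (M : VonNeumannAlgebra H) : Prop :=
  ∀ x ∈ M, x ∈ M.commutant → ∃ c : ℂ, x = c • (1 : H →L[ℂ] H)

/-- `M` is a II₁ factor with trace `τ`: an infinite dimensional factor on which `τ` is a faithful
normal tracial state (such a `τ` is unique). -/
structure IsIIOneFactor (M : VonNeumannAlgebra H) (τ : M.toStarSubalgebra →ₗ[ℂ] ℂ) : Prop where
  factor : IsFactor M
  infinite : ¬ FiniteDimensional ℂ M.toStarSubalgebra
  trace : IsFaithfulNormalTracialState M τ

/-- The norm `‖x‖₂ = τ(x* x)^{1/2}`. -/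
def twoNorm {M : VonNeumannAlgebra H} (τ : M.toStarSubalgebra →ₗ[ℂ] ℂ)
    (x : M.toStarSubalgebra) : ℝ :=
  Real.sqrt (τ (star x * x)).re

/-- Property Gamma of Murray and von Neumann for `M` with trace `τ`: there are unitaries `uₙ ∈ M`
of trace zero with `‖uₙ x - x uₙ‖₂ → 0` for every `x ∈ M`. -/
def HasPropertyGamma (M : VonNeumannAlgebra H) (τ : M.toStarSubalgebra →ₗ[ℂ] ℂ) : Prop :=
  ∃ u : ℕ → M.toStarSubalgebra, (∀ n, u n ∈ unitary M.toStarSubalgebra) ∧ (∀ n, τ (u n) = 0) ∧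
    ∀ x : M.toStarSubalgebra, Tendsto (fun n => twoNorm τ (u n * x - x * u n)) atTop (𝓝 0)

end VN

/-! ### Group von Neumann algebras -/

/-- The group von Neumann algebra `L(G)`, generated by the left regular representation. -/
def groupVN (G : Type u) [Group G] : VonNeumannAlgebra ℓ²(G, ℂ) :=
  generated (Set.range fun g : G =>
    ((leftRegular G g).toContinuousLinearEquiv : ℓ²(G, ℂ) →L[ℂ] ℓ²(G, ℂ)))

/-- The canonical trace of `L(G)`, `τ(x) = ⟨x δ_e, δ_e⟩`. -/
def groupTrace (G : Type u) [Group G] : (groupVN G).toStarSubalgebra →ₗ[ℂ] ℂ where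
  toFun x := inner ℂ (delta (1 : G)) ((x : ℓ²(G, ℂ) →L[ℂ] ℓ²(G, ℂ)) (delta 1))
  map_add' x y := by simp
  map_smul' c x := by simp

end GroupVN

end

/-! Everything follows from the failure of inner amenability. Sort the elements of Γ outside Λ by
the factors `i`, `j` of the first and last letters of a reduced product, and let `f` be an almost
conjugation-invariant unit vector. Conjugation by a letter `a` of Γ₁ maps class (1,1) into class
(0,0), while letters `b`, `c` of Γ₂ in different nontrivial cosets map class (0,0) to two disjoint
subsets of class (1,1). So both classes have small mass, and the mixed classes reduce to (1,1):
`|f|²` lives almost entirely on Λ (`conjMass_compl_base_range_le`), hence on every `gᵢΛgᵢ⁻¹`, hence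
on their intersection `{e}`, where `f` has no mass.

For a nontrivial group G that is not inner amenable, `x ↦ x δ_e` transports the rest to ℓ²(G):
central elements give conjugation-invariant vectors, and the unitaries of property Gamma give almost
invariant unit vectors vanishing at `e`. -/

namespace Monoid.PushoutI

/-! ### Reduced products in an amalgam -/

section ReducedProd

variable {ι : Type*} {G : ι → Type*} {H : Type*} [∀ i, Group (G i)] [Group H]
  {φ : ∀ i, H →* G i}

variable (φ) in
/-- `IsReducedProd φ i j x` says that `x` is a nonempty product of letters outside the amalgamated
subgroup, consecutive ones from different factors, the first from `G i` and the last from `G j`. -/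
inductive IsReducedProd : ι → ι → PushoutI φ → Prop
  | letter {i : ι} {a : G i} (ha : a ∉ (φ i).range) : IsReducedProd i i (of i a)
  | letter_mul {i j k : ι} {a : G i} {x : PushoutI φ} (ha : a ∉ (φ i).range) (hij : i ≠ j)
      (hx : IsReducedProd j k x) : IsReducedProd i k (of i a * x)

namespace IsReducedProd

theorem mul {i j k l : ι} {x y : PushoutI φ} (hx : IsReducedProd φ i j x)
    (hy : IsReducedProd φ k l y) (hjk : j ≠ k) : IsReducedProd φ i l (x * y) := by
  induction hx with
  | letter ha => exact letter_mul ha hjk hy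
  | letter_mul ha hij _ ih => rw [mul_assoc]; exact letter_mul ha hij (ih hjk)

theorem inv {i j : ι} {x : PushoutI φ} (hx : IsReducedProd φ i j x) :
    IsReducedProd φ j i x⁻¹ := by
  induction hx with
  | letter ha => rw [← map_inv]; exact letter (by simpa using ha)
  | letter_mul ha hij _ ih =>
    rw [mul_inv_rev, ← map_inv]
    exact ih.mul (letter (by simpa using ha)) hij.symm

theorem exists_normalWord (d : NormalWord.Transversal φ) {i j : ι} {x : PushoutI φ}
    (hx : IsReducedProd φ i j x) :
    ∃ w : NormalWord d, w.prod = x ∧ w.fstIdx = some i := by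
  induction hx with
  | letter ha =>
    refine ⟨NormalWord.cons _ NormalWord.empty (by simp [CoprodI.Word.fstIdx]) ha,
      by simp, ?_⟩
    simp [CoprodI.Word.fstIdx, NormalWord.cons]
  | letter_mul ha hij _ ih =>
    obtain ⟨w, rfl, hw⟩ := ih
    refine ⟨NormalWord.cons _ w (by rw [hw]; simpa using hij.symm) ha, by simp, ?_⟩
    simp [CoprodI.Word.fstIdx, NormalWord.cons]

/-- The normal form theorem enters only here: it is what makes the classes by first letter disjoint.
-/
theorem fst_unique (hφ : ∀ i, Function.Injective (φ i)) {i j k l : ι} {x : PushoutI φ}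
    (hx : IsReducedProd φ i j x) (hx' : IsReducedProd φ k l x) : i = k := by
  obtain ⟨d⟩ := NormalWord.transversal_nonempty φ hφ
  obtain ⟨w, hw, hi⟩ := hx.exists_normalWord d
  obtain ⟨w', hw', hk⟩ := hx'.exists_normalWord d
  obtain rfl := NormalWord.prod_injective (hw.trans hw'.symm)
  simpa [hi] using hk

theorem base_mul {i j : ι} {x : PushoutI φ} (h : H) (hx : IsReducedProd φ i j x) :
    IsReducedProd φ i j (base φ h * x) := by
  cases hx with
  | letter ha =>
    rw [← of_apply_eq_base φ i, ← map_mul]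
    exact letter ((Subgroup.mul_mem_cancel_left _ (MonoidHom.mem_range.2 ⟨h, rfl⟩)).not.2 ha)
  | letter_mul ha hij hx =>
    rw [← of_apply_eq_base φ i, ← mul_assoc, ← map_mul]
    exact letter_mul ((Subgroup.mul_mem_cancel_left _ (MonoidHom.mem_range.2 ⟨h, rfl⟩)).not.2 ha)
      hij hx

/-- Conjugating by a letter of another factor than both ends of a reduced product. -/
theorem conj {i j k : ι} {x : PushoutI φ} (hx : IsReducedProd φ i j x) {a : G k}
    (ha : a ∉ (φ k).range) (hi : k ≠ i) (hj : j ≠ k) :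
    IsReducedProd φ k k (of k a * x * (of k a)⁻¹) :=
  (letter_mul ha hi hx).mul (letter ha).inv hj

end IsReducedProd

theorem of_mul_mem_base_range_or_isReducedProd (i : ι) (a : G i) {x : PushoutI φ}
    (hx : x ∈ (base φ).range ∨ ∃ i j, IsReducedProd φ i j x) :
    of i a * x ∈ (base φ).range ∨ ∃ j k, IsReducedProd φ j k (of i a * x) := by
  have key (a : G i) : of i a ∈ (base φ).range ∨ ∃ j k, IsReducedProd φ j k (of i a) := by
    by_cases ha : a ∈ (φ i).range
    · obtain ⟨h, rfl⟩ := ha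
      exact .inl ⟨h, (of_apply_eq_base φ i h).symm⟩
    · exact .inr ⟨i, i, .letter ha⟩
  have main {j k : ι} (a : G i) {y : PushoutI φ} (hij : i ≠ j) (hy : IsReducedProd φ j k y) :
      ∃ i' j', IsReducedProd φ i' j' (of i a * y) := by
    by_cases ha : a ∈ (φ i).range
    · obtain ⟨h, rfl⟩ := ha
      rw [of_apply_eq_base]
      exact ⟨j, k, hy.base_mul h⟩
    · exact ⟨i, k, .letter_mul ha hij hy⟩
  obtain ⟨h, rfl⟩ | ⟨j, k, hx⟩ := hx
  · rw [← of_apply_eq_base φ i, ← map_mul]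
    exact key _
  · by_cases hij : i = j
    · subst hij
      cases hx with
      | letter _ => rw [← map_mul]; exact key _
      | letter_mul _ hij hy => rw [← mul_assoc, ← map_mul]; exact .inr (main _ hij hy)
    · exact .inr (main a hij hx)

theorem mem_base_range_or_isReducedProd (x : PushoutI φ) :
    x ∈ (base φ).range ∨ ∃ i j, IsReducedProd φ i j x := by
  -- Generalizing to `x * y` lets an induction on `x` act by left multiplication.
  suffices h : ∀ x y : PushoutI φ, (y ∈ (base φ).range ∨ ∃ i j, IsReducedProd φ i j y) →
      x * y ∈ (base φ).range ∨ ∃ i j, IsReducedProd φ i j (x * y) by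
    simpa using h x 1 (.inl (one_mem _))
  intro x
  induction x using PushoutI.induction_on with
  | of i a => exact fun y => of_mul_mem_base_range_or_isReducedProd i a
  | base h =>
    rintro y (hy | ⟨i, j, hy⟩)
    · exact .inl (mul_mem ⟨h, rfl⟩ hy)
    · exact .inr ⟨i, j, hy.base_mul h⟩
  | mul x₁ x₂ ih₁ ih₂ =>
    intro y hy
    rw [mul_assoc]
    exact ih₁ _ (ih₂ y hy)

end ReducedProd

section TwoFactors

variable {Γ : Fin 2 → Type*} {Λ : Type*} [∀ i, Group (Γ i)] [Group Λ] {φ : ∀ i, Λ →* Γ i}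

/-- The first letter `s` cannot lie in both cosets `bΛ` and `cΛ`; for the one that misses it, `t⁻¹s`
is still a letter and nothing cancels. -/
theorem IsReducedProd.conj_inv_mem_of_one_zero {x : PushoutI φ} (hx : IsReducedProd φ 1 0 x)
    {b c : Γ 1} (hb : b ∉ (φ 1).range) (hc : c ∉ (φ 1).range) (hbc : b⁻¹ * c ∉ (φ 1).range) :
    IsReducedProd φ 1 1 ((of 1 b)⁻¹ * x * of 1 b) ∨
      IsReducedProd φ 1 1 ((of 1 c)⁻¹ * x * of 1 c) := by
  cases hx with
  | @letter_mul _ j _ s y hs hij hy =>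
    obtain rfl : j = 0 := by omega
    have key (t : Γ 1) (ht : t ∉ (φ 1).range) (hts : t⁻¹ * s ∉ (φ 1).range) :
        IsReducedProd φ 1 1 ((of 1 t)⁻¹ * (of 1 s * y) * of 1 t) := by
      rw [← mul_assoc, ← map_inv, ← map_mul]
      exact (IsReducedProd.letter_mul hts (by decide) hy).mul (.letter ht) (by decide)
    by_cases hbs : b⁻¹ * s ∈ (φ 1).range
    · refine .inr (key c hc fun hcs => hbc ?_)
      have := mul_mem hbs (inv_mem hcs)
      rwa [mul_inv_rev, inv_inv, mul_assoc, mul_inv_cancel_left] at this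
    · exact .inl (key b hb hbs)

theorem IsReducedProd.conj_inv_mem_of_zero_one {x : PushoutI φ} (hx : IsReducedProd φ 0 1 x)
    {b c : Γ 1} (hb : b ∉ (φ 1).range) (hc : c ∉ (φ 1).range) (hbc : b⁻¹ * c ∉ (φ 1).range) :
    IsReducedProd φ 1 1 ((of 1 b)⁻¹ * x * of 1 b) ∨
      IsReducedProd φ 1 1 ((of 1 c)⁻¹ * x * of 1 c) := by
  refine (hx.inv.conj_inv_mem_of_one_zero hb hc hbc).imp (fun h => ?_) fun h => ?_ <;>
  simpa [mul_assoc] using h.inv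

end TwoFactors

end Monoid.PushoutI

/-! ### Letters supplied by the index hypotheses -/

theorem Subgroup.exists_notMem_of_two_le_card {G : Type*} [Group G] {K : Subgroup G}
    (h : 2 ≤ ENat.card (G ⧸ K)) : ∃ a, a ∉ K := by
  by_contra! hK
  obtain rfl : K = ⊤ := by ext; simp [hK]
  have : ENat.card (G ⧸ (⊤ : Subgroup G)) ≤ 1 := ENat.card_le_one_iff_subsingleton _ |>.2
    QuotientGroup.subsingleton_quotient_top
  exact absurd (h.trans this) (by decide)

theorem Subgroup.exists_notMem_of_three_le_card {G : Type*} [Group G] {K : Subgroup G}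
    (h : 3 ≤ ENat.card (G ⧸ K)) : ∃ b c, b ∉ K ∧ c ∉ K ∧ b⁻¹ * c ∉ K := by
  rw [← Set.encard_univ] at h
  obtain ⟨t, -, ht⟩ := Set.exists_subset_encard_eq h
  obtain ⟨x, y, z, hxy, hxz, hyz, -⟩ := Set.encard_eq_three.1 ht
  obtain ⟨x, rfl⟩ := QuotientGroup.mk_surjective x
  obtain ⟨y, rfl⟩ := QuotientGroup.mk_surjective y
  obtain ⟨z, rfl⟩ := QuotientGroup.mk_surjective z
  rw [ne_eq, QuotientGroup.eq] at hxy hxz hyz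
  -- Translating three distinct cosets so that the first becomes `K`.
  exact ⟨x⁻¹ * y, x⁻¹ * z, hxy, hxz, by simpa [mul_assoc] using hyz⟩

noncomputable section

namespace GroupVN

universe u

/-! ### Mass distribution of square summable functions -/

section Mass

variable {X : Type u}

/-- The restriction of a square summable function to a set, extended by zero. -/
def restrict (A : Set X) (f : ℓ²(X, ℂ)) : ℓ²(X, ℂ) :=
  ⟨A.indicator f, memℓp_gen (by
    have h := (lp.memℓp f).summable (by simp)
    refine h.of_nonneg_of_le (fun x => by positivity) fun x => ?_
    gcongr
    exact norm_indicator_le_norm_self _ _)⟩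

theorem restrict_apply (A : Set X) (f : ℓ²(X, ℂ)) (x : X) :
    restrict A f x = A.indicator f x := rfl

theorem norm_sq_eq_tsum (f : ℓ²(X, ℂ)) : ‖f‖ ^ 2 = ∑' x, ‖f x‖ ^ 2 := by
  simpa using lp.norm_rpow_eq_tsum (p := 2) (by simp) f

theorem summable_norm_sq (f : ℓ²(X, ℂ)) : Summable fun x => ‖f x‖ ^ 2 := by
  simpa using (lp.memℓp f).summable (by simp)

theorem norm_restrict_le (A : Set X) (f : ℓ²(X, ℂ)) : ‖restrict A f‖ ≤ ‖f‖ :=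
  lp.norm_mono (by simp) fun _ => norm_indicator_le_norm_self _ _

theorem restrict_sub (A : Set X) (f g : ℓ²(X, ℂ)) :
    restrict A (f - g) = restrict A f - restrict A g :=
  lp.ext (Set.indicator_sub A f g)

/-- The mass that `|f|²` gives to a set. -/
def mass (f : ℓ²(X, ℂ)) (A : Set X) : ℝ := ‖restrict A f‖ ^ 2

theorem mass_eq_tsum (f : ℓ²(X, ℂ)) (A : Set X) :
    mass f A = ∑' x, A.indicator (fun x => ‖f x‖ ^ 2) x := by
  rw [mass, norm_sq_eq_tsum]
  congr 1 with x
  by_cases hx : x ∈ A <;> simp [restrict_apply, hx]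

theorem mass_univ (f : ℓ²(X, ℂ)) : mass f Set.univ = ‖f‖ ^ 2 := by
  simp [mass_eq_tsum, norm_sq_eq_tsum]

theorem mass_empty (f : ℓ²(X, ℂ)) : mass f ∅ = 0 := by
  simp [mass_eq_tsum]

theorem mass_mono (f : ℓ²(X, ℂ)) {A B : Set X} (h : A ⊆ B) : mass f A ≤ mass f B := by
  rw [mass_eq_tsum, mass_eq_tsum]
  exact Summable.tsum_le_tsum
    (fun x => Set.indicator_le_indicator_of_subset h (fun _ => by positivity) x)
    ((summable_norm_sq f).indicator A) ((summable_norm_sq f).indicator B)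

theorem mass_union_add_mass_inter (f : ℓ²(X, ℂ)) (A B : Set X) :
    mass f (A ∪ B) + mass f (A ∩ B) = mass f A + mass f B := by
  simp only [mass_eq_tsum]
  rw [← Summable.tsum_add ((summable_norm_sq f).indicator _) ((summable_norm_sq f).indicator _),
    ← Summable.tsum_add ((summable_norm_sq f).indicator _) ((summable_norm_sq f).indicator _)]
  congr 1 with x
  exact Set.indicator_union_add_inter_apply _ _ _ _

theorem mass_union_le (f : ℓ²(X, ℂ)) (A B : Set X) :
    mass f (A ∪ B) ≤ mass f A + mass f B := by
  have := mass_union_add_mass_inter f A B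
  have : 0 ≤ mass f (A ∩ B) := by unfold mass; positivity
  linarith

theorem mass_add_le_of_disjoint (f : ℓ²(X, ℂ)) {A B C : Set X} (h : Disjoint A B) (hA : A ⊆ C)
    (hB : B ⊆ C) : mass f A + mass f B ≤ mass f C := by
  rw [← mass_union_add_mass_inter, h.inter_eq, mass_empty, add_zero]
  exact mass_mono f (Set.union_subset hA hB)

theorem mass_iUnion_le {ι : Type*} [Fintype ι] (f : ℓ²(X, ℂ)) (A : ι → Set X) :
    mass f (⋃ i, A i) ≤ ∑ i, mass f (A i) := by
  classical
  suffices h : ∀ s : Finset ι, mass f (⋃ i ∈ s, A i) ≤ ∑ i ∈ s, mass f (A i) by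
    simpa using h Finset.univ
  intro s
  induction s using Finset.induction_on with
  | empty => simp [mass_empty]
  | insert i s his ih =>
    rw [Finset.set_biUnion_insert, Finset.sum_insert his]
    exact (mass_union_le _ _ _).trans (by gcongr)

/-- A difference of squares: `p² - q² = (p + q)(p - q)` with `p + q ≤ 2`. -/
theorem mass_le_add (f g : ℓ²(X, ℂ)) (hf : ‖f‖ ≤ 1) (hg : ‖g‖ ≤ 1) (A : Set X) :
    mass f A ≤ mass g A + 2 * ‖f - g‖ := by
  have h₁ := norm_restrict_le A (f - g)
  have h₂ := (norm_restrict_le A f).trans hf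
  have h₃ := (norm_restrict_le A g).trans hg
  have h₄ := norm_sub_norm_le (restrict A f) (restrict A g)
  rw [← restrict_sub] at h₄
  unfold mass
  nlinarith [norm_nonneg (restrict A f), norm_nonneg (restrict A g), norm_nonneg (f - g)]

theorem mass_permUnitary (σ : Equiv.Perm X) (f : ℓ²(X, ℂ)) (A : Set X) :
    mass (permUnitary σ f) A = mass f (σ ⁻¹' A) := by
  rw [mass_eq_tsum, mass_eq_tsum, ← Equiv.tsum_eq σ]
  congr 1 with x
  by_cases hx : σ x ∈ A <;> simp [permUnitary_apply, hx]

theorem mass_preimage_le (σ : Equiv.Perm X) (f : ℓ²(X, ℂ)) (hf : ‖f‖ = 1) {ε : ℝ}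
    (hσ : ‖permUnitary σ f - f‖ < ε) (A : Set X) : mass f (σ ⁻¹' A) ≤ mass f A + 2 * ε := by
  rw [← mass_permUnitary]
  have := mass_le_add (permUnitary σ f) f (by rw [LinearIsometryEquiv.norm_map, hf]) hf.le A
  linarith

end Mass

section ConjMass

variable {G : Type u} [Group G]

/-- The mass that `|f|²` gives to the nontrivial elements of a subset of `G`. -/
def conjMass (f : ℓ²({h : G // h ≠ 1}, ℂ)) (A : Set G) : ℝ := mass f (Subtype.val ⁻¹' A)

theorem conjMass_le_of_conj_mem {f : ℓ²({h : G // h ≠ 1}, ℂ)} (hf : ‖f‖ = 1) {ε : ℝ} {g : G}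
    (hg : ‖conjRep G g f - f‖ < ε) {A B : Set G} (hAB : ∀ x ∈ A, g * x * g⁻¹ ∈ B) :
    conjMass f A ≤ conjMass f B + 2 * ε :=
  (mass_mono f fun x hx => hAB x.1 hx).trans
    (mass_preimage_le (conjPerm G g) f hf hg (Subtype.val ⁻¹' B))

theorem conjMass_mono (f : ℓ²({h : G // h ≠ 1}, ℂ)) {A B : Set G} (h : A ⊆ B) :
    conjMass f A ≤ conjMass f B :=
  mass_mono f (Set.preimage_mono h)

theorem conjMass_union_le (f : ℓ²({h : G // h ≠ 1}, ℂ)) (A B : Set G) :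
    conjMass f (A ∪ B) ≤ conjMass f A + conjMass f B :=
  mass_union_le f _ _

end ConjMass

/-! ### The paradoxical conjugation argument -/

open Monoid.PushoutI in
/-- An almost conjugation invariant unit vector has almost all of its mass on the amalgamated
subgroup. -/
theorem conjMass_compl_base_range_le {Γ : Fin 2 → Type*} {Λ : Type*} [∀ i, Group (Γ i)] [Group Λ]
    {φ : ∀ i, Λ →* Γ i} (hφ : ∀ i, Function.Injective (φ i)) {a : Γ 0} {b c : Γ 1}
    (ha : a ∉ (φ 0).range) (hb : b ∉ (φ 1).range) (hc : c ∉ (φ 1).range)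
    (hbc : b⁻¹ * c ∉ (φ 1).range) {f : ℓ²({h : Monoid.PushoutI φ // h ≠ 1}, ℂ)} (hf : ‖f‖ = 1)
    {ε : ℝ} (hfa : ‖conjRep _ (of 0 a) f - f‖ < ε) (hfb : ‖conjRep _ (of 1 b) f - f‖ < ε)
    (hfc : ‖conjRep _ (of 1 c) f - f‖ < ε) (hfb' : ‖conjRep _ (of 1 b)⁻¹ f - f‖ < ε)
    (hfc' : ‖conjRep _ (of 1 c)⁻¹ f - f‖ < ε) :
    conjMass f ((base φ).range : Set (Monoid.PushoutI φ))ᶜ ≤ 54 * ε := by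
  set S : Fin 2 → Fin 2 → Set (Monoid.PushoutI φ) := fun i j => {x | IsReducedProd φ i j x}
  have h₁ : conjMass f (S 1 1) ≤ conjMass f (S 0 0) + 2 * ε :=
    conjMass_le_of_conj_mem hf hfa fun x hx => hx.conj ha (by decide) (by decide)
  have hconj (t : Γ 1) (hft : ‖conjRep _ (of 1 t) f - f‖ < ε) :
      conjMass f (S 0 0) ≤ conjMass f {y | (of 1 t)⁻¹ * y * of 1 t ∈ S 0 0} + 2 * ε :=
    conjMass_le_of_conj_mem hf hft fun x hx => by simpa [mul_assoc] using hx
  have hsub (t : Γ 1) (ht : t ∉ (φ 1).range) :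
      {y | (of 1 t)⁻¹ * y * of 1 t ∈ S 0 0} ⊆ S 1 1 := fun y hy => by
    show IsReducedProd φ 1 1 y
    simpa [mul_assoc] using
      (IsReducedProd.conj (show IsReducedProd φ 0 0 _ from hy) ht (by decide) (by decide))
  have h₂ : conjMass f {y | (of 1 b)⁻¹ * y * of 1 b ∈ S 0 0} +
      conjMass f {y | (of 1 c)⁻¹ * y * of 1 c ∈ S 0 0} ≤ conjMass f (S 1 1) := by
    refine mass_add_le_of_disjoint f (Disjoint.preimage _ (Set.disjoint_left.2 fun y hyb hyc => ?_))
      (Set.preimage_mono (hsub b hb)) (Set.preimage_mono (hsub c hc))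
    -- Conjugating `c⁻¹yc` by the letter `b⁻¹c` gives `b⁻¹yb`, which would then start in both
    -- factors.
    have := IsReducedProd.conj (show IsReducedProd φ 0 0 _ from hyc) hbc (by decide) (by decide)
    refine absurd (IsReducedProd.fst_unique hφ this (k := 0) (l := 0) ?_) (by decide)
    simpa [mul_assoc] using (show IsReducedProd φ 0 0 _ from hyb)
  have hmix (i j : Fin 2) (hij : S i j ⊆ {x | (of 1 b)⁻¹ * x * of 1 b ∈ S 1 1} ∪
      {x | (of 1 c)⁻¹ * x * of 1 c ∈ S 1 1}) :
      conjMass f (S i j) ≤ 2 * conjMass f (S 1 1) + 4 * ε := by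
    have hb₁ : conjMass f {x | (of 1 b)⁻¹ * x * of 1 b ∈ S 1 1} ≤ conjMass f (S 1 1) + 2 * ε :=
      conjMass_le_of_conj_mem hf hfb' fun x hx => by simpa using hx
    have hc₁ : conjMass f {x | (of 1 c)⁻¹ * x * of 1 c ∈ S 1 1} ≤ conjMass f (S 1 1) + 2 * ε :=
      conjMass_le_of_conj_mem hf hfc' fun x hx => by simpa using hx
    have := (conjMass_mono f hij).trans (conjMass_union_le f _ _)
    linarith
  have h₀₁ := hmix 0 1 fun x (hx : IsReducedProd φ _ _ x) => hx.conj_inv_mem_of_zero_one hb hc hbc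
  have h₁₀ := hmix 1 0 fun x (hx : IsReducedProd φ _ _ x) => hx.conj_inv_mem_of_one_zero hb hc hbc
  have hcover : ((base φ).range : Set (Monoid.PushoutI φ))ᶜ ⊆
      (S 0 0 ∪ S 1 1) ∪ (S 0 1 ∪ S 1 0) := by
    intro x hx
    obtain ⟨i, j, h⟩ := (mem_base_range_or_isReducedProd x).resolve_left hx
    fin_cases i <;> fin_cases j
    · exact .inl (.inl h)
    · exact .inr (.inl h)
    · exact .inr (.inr h)
    · exact .inl (.inr h)
  have h₃ := (conjMass_mono f hcover).trans (conjMass_union_le f _ _)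
  have h₄ := conjMass_union_le f (S 0 0) (S 1 1)
  have h₅ := conjMass_union_le f (S 0 1) (S 1 0)
  have h₆ := hconj b hfb
  have h₇ := hconj c hfc
  -- With `p`, `q` the masses of `S 0 0`, `S 1 1`: `2p - 4ε ≤ q ≤ p + 2ε` gives `p ≤ 6ε` and `q ≤
  -- 8ε`. Each mixed class has mass at most `2q + 4ε ≤ 20ε`, and `6 + 8 + 20 + 20 = 54`.
  linarith

open Monoid.PushoutI in
theorem not_innerAmenable_pushoutI {Γ : Fin 2 → Type*} {Λ : Type*} [∀ i, Group (Γ i)] [Group Λ]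
    (φ : ∀ i, Λ →* Γ i) (hφ : ∀ i, Function.Injective (φ i))
    (h₁ : 2 ≤ ENat.card (Γ 0 ⧸ (φ 0).range)) (h₂ : 3 ≤ ENat.card (Γ 1 ⧸ (φ 1).range))
    (m : ℕ) (g : Fin m → Monoid.PushoutI φ)
    (hg : ⨅ i, (base φ).range.map (MulAut.conj (g i)).toMonoidHom = ⊥) :
    ¬ InnerAmenable (Monoid.PushoutI φ) := by
  classical
  intro h
  obtain ⟨a, ha⟩ := Subgroup.exists_notMem_of_two_le_card h₁
  obtain ⟨b, c, hb, hc, hbc⟩ := Subgroup.exists_notMem_of_three_le_card h₂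
  -- Chosen so that `m · 56ε = m / (m + 1) < 1`, also for `m = 0`; 56 is 54 plus 2 for moving by
  -- `gᵢ⁻¹`.
  set ε : ℝ := 1 / (56 * (m + 1)) with hε
  obtain ⟨f, hf, hF⟩ := h
    ({of 0 a, of 1 b, of 1 c, (of 1 b)⁻¹, (of 1 c)⁻¹} ∪ Finset.univ.image fun i => (g i)⁻¹) ε
    (by positivity)
  have hbase := conjMass_compl_base_range_le hφ ha hb hc hbc hf (hF _ (by simp)) (hF _ (by simp))
    (hF _ (by simp)) (hF _ (by simp)) (hF _ (by simp))
  set L : Set (Monoid.PushoutI φ) := ((base φ).range : Set (Monoid.PushoutI φ))ᶜ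
  have hi (i : Fin m) : conjMass f {x | (g i)⁻¹ * x * g i ∈ L} ≤ 56 * ε := by
    have : conjMass f {x | (g i)⁻¹ * x * g i ∈ L} ≤ conjMass f L + 2 * ε :=
      conjMass_le_of_conj_mem hf (hF (g i)⁻¹ (by simp)) fun x hx => by simpa using hx
    linarith
  have hcover : (Set.univ : Set {h : Monoid.PushoutI φ // h ≠ 1}) ⊆
      ⋃ i, Subtype.val ⁻¹' {x | (g i)⁻¹ * x * g i ∈ L} := by
    rintro ⟨x, hx⟩ -
    by_contra hcon
    refine hx ((Subgroup.mem_bot (G := Monoid.PushoutI φ)).1 (hg ▸ Subgroup.mem_iInf.2 fun i => ?_))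
    have : (g i)⁻¹ * x * g i ∈ (base φ).range := by
      by_contra hxi
      exact hcon (Set.mem_iUnion.2 ⟨i, hxi⟩)
    exact ⟨_, this, by simp [mul_assoc]⟩
  have h₃ := ((mass_mono f hcover).trans (mass_iUnion_le f _)).trans
    (Finset.sum_le_sum fun i _ => hi i)
  rw [mass_univ, hf, Finset.sum_const, Finset.card_univ, Fintype.card_fin, nsmul_eq_mul, hε] at h₃
  have : (m : ℝ) * (56 * (1 / (56 * (m + 1)))) = m / (m + 1) := by field_simp
  rw [this, one_pow, le_div_iff₀ (by positivity)] at h₃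
  linarith

/-! ### Basis vectors and invariant vectors in ℓ²(G) -/

section Delta

variable {X : Type u}

theorem inner_delta (x : X) (f : ℓ²(X, ℂ)) : inner ℂ (delta x) f = f x := by
  classical
  have h : delta x = lp.single 2 x (1 : ℂ) := by unfold delta; congr!
  rw [h, lp.inner_single_left]
  simp

theorem delta_self (x : X) : delta x x = 1 := by
  simp [delta]

theorem delta_of_ne {x y : X} (h : y ≠ x) : delta x y = 0 := by
  simp [delta, h]

theorem norm_delta (x : X) : ‖delta x‖ = 1 := by
  simp [delta, lp.norm_single]

theorem orthonormal_delta : Orthonormal ℂ (delta : X → ℓ²(X, ℂ)) :=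
  ⟨norm_delta, fun x y h => (inner_delta x (delta y)).trans (delta_of_ne h)⟩

theorem ext_of_delta {E : Type*} [NormedAddCommGroup E] [NormedSpace ℂ E]
    {S T : ℓ²(X, ℂ) →L[ℂ] E} (h : ∀ x, S (delta x) = T (delta x)) : S = T := by
  classical
  refine lp.ext_continuousLinearMap (by simp) fun x => ?_
  ext
  have := h x
  unfold delta at this
  convert! this

end Delta

section InnerAmenable

variable {G : Type u} [Group G]

/-- The unitary on `ℓ²(G)` induced by conjugation with `g`. -/
def conjUnitary (g : G) : ℓ²(G, ℂ) ≃ₗᵢ[ℂ] ℓ²(G, ℂ) := permUnitary (MulAut.conj g).toEquiv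

theorem conjUnitary_apply (g : G) (f : ℓ²(G, ℂ)) (h : G) :
    conjUnitary g f h = f (g⁻¹ * h * g) := by
  simp [conjUnitary, permUnitary_apply]

theorem conjUnitary_delta_one (g : G) : conjUnitary g (delta 1) = delta 1 := by
  simp [conjUnitary, permUnitary_delta]

/-- Restriction of a square summable function on `G` to `G ∖ {e}`. -/
def puncture (f : ℓ²(G, ℂ)) : ℓ²({h : G // h ≠ 1}, ℂ) :=
  ⟨fun h => f h.1, memℓp_gen (((lp.memℓp f).summable (by simp)).comp_injective
    Subtype.val_injective)⟩

theorem puncture_apply (f : ℓ²(G, ℂ)) (h : {h : G // h ≠ 1}) : puncture f h = f h.1 := rfl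

theorem norm_puncture_le (f : ℓ²(G, ℂ)) : ‖puncture f‖ ≤ ‖f‖ := by
  refine le_of_sq_le_sq ?_ (norm_nonneg _)
  rw [norm_sq_eq_tsum, norm_sq_eq_tsum]
  exact (summable_norm_sq f).tsum_subtype_le (fun h => ‖f h‖ ^ 2) {h | h ≠ 1}
    (fun _ => by positivity)

theorem norm_puncture_of_apply_one {f : ℓ²(G, ℂ)} (hf : f 1 = 0) : ‖puncture f‖ = ‖f‖ := by
  rw [← sq_eq_sq₀ (norm_nonneg _) (norm_nonneg _), norm_sq_eq_tsum, norm_sq_eq_tsum]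
  refine tsum_subtype_eq_of_support_subset (f := fun h => ‖f h‖ ^ 2) (s := {h | h ≠ 1}) ?_
  rintro h hh rfl
  simp [hf] at hh

theorem conjRep_puncture (g : G) (f : ℓ²(G, ℂ)) :
    conjRep G g (puncture f) = puncture (conjUnitary g f) := by
  ext h
  rw [puncture_apply, conjUnitary_apply]
  rfl

theorem innerAmenable_of_forall_exists (h : ∀ (F : Finset G) (ε : ℝ), 0 < ε → ∃ f : ℓ²(G, ℂ),
    ‖f‖ = 1 ∧ f 1 = 0 ∧ ∀ g ∈ F, ‖conjUnitary g f - f‖ < ε) : InnerAmenable G := by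
  intro F ε hε
  obtain ⟨f, hf, hf₁, hF⟩ := h F ε hε
  refine ⟨puncture f, by rw [norm_puncture_of_apply_one hf₁, hf], fun g hg => ?_⟩
  rw [conjRep_puncture]
  exact (norm_puncture_le (conjUnitary g f - f)).trans_lt (hF g hg)

theorem innerAmenable_of_invariant {f : ℓ²(G, ℂ)} (hf : f ≠ 0) (hf₁ : f 1 = 0)
    (hinv : ∀ g, conjUnitary g f = f) : InnerAmenable G := by
  refine innerAmenable_of_forall_exists fun F ε hε => ⟨(‖f‖⁻¹ : ℂ) • f, ?_, ?_, fun g _ => ?_⟩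
  · simp [norm_smul, hf]
  · simp [hf₁]
  · simpa [map_smul, hinv] using hε

/-- On a finite group the indicator of `G ∖ {e}` is an invariant vector. -/
theorem infinite_of_not_innerAmenable [Nontrivial G] (h : ¬ InnerAmenable G) : Infinite G := by
  classical
  by_contra hG
  rw [not_infinite_iff_finite] at hG
  obtain ⟨a, ha⟩ := exists_ne (1 : G)
  refine h (innerAmenable_of_invariant (f := ⟨fun g => if g = 1 then 0 else 1, Memℓp.all _⟩)
    (fun h₀ => ?_) (if_pos rfl) fun g => ?_)
  · have := congrArg (fun f : ℓ²(G, ℂ) => f a) h₀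
    simp [ha] at this
  · ext k
    rw [conjUnitary_apply]
    have : g⁻¹ * k * g = 1 ↔ k = 1 := by
      simpa using conj_eq_one_iff (a := g⁻¹) (b := k)
    simp [this]

end InnerAmenable

/-! ### The group von Neumann algebra -/

section GroupVN

variable {G : Type u} [Group G]

/-- Left translation as a bounded operator. -/
def leftOp (g : G) : ℓ²(G, ℂ) →L[ℂ] ℓ²(G, ℂ) :=
  ((leftRegular G g).toContinuousLinearEquiv : ℓ²(G, ℂ) →L[ℂ] ℓ²(G, ℂ))

/-- Right translation `δ_h ↦ δ_{h g}`. -/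
def rightTranslation (g : G) : ℓ²(G, ℂ) ≃ₗᵢ[ℂ] ℓ²(G, ℂ) := permUnitary (Equiv.mulRight g)

/-- Right translation as a bounded operator. -/
def rightOp (g : G) : ℓ²(G, ℂ) →L[ℂ] ℓ²(G, ℂ) :=
  ((rightTranslation g).toContinuousLinearEquiv : ℓ²(G, ℂ) →L[ℂ] ℓ²(G, ℂ))

theorem leftOp_apply (g : G) (f : ℓ²(G, ℂ)) (h : G) : leftOp g f h = f (g⁻¹ * h) := rfl

theorem rightOp_apply (g : G) (f : ℓ²(G, ℂ)) (h : G) : rightOp g f h = f (h * g⁻¹) := rfl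

theorem leftOp_delta (g h : G) : leftOp g (delta h) = delta (g * h) :=
  permUnitary_delta _ _

theorem rightOp_delta (g h : G) : rightOp g (delta h) = delta (h * g) :=
  permUnitary_delta _ _

theorem norm_rightOp (g : G) (f : ℓ²(G, ℂ)) : ‖rightOp g f‖ = ‖f‖ :=
  (rightTranslation g).norm_map f

/-- As `x` in `L(G)` commutes with right translations, this turns the commutator of `x` with `leftOp
g`, applied to `δ_e`, into the displacement of `x δ_e` under conjugation, up to an isometry. -/
theorem rightOp_conjUnitary (g : G) (f : ℓ²(G, ℂ)) :
    rightOp g (conjUnitary g f) = leftOp g f := by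
  ext h
  rw [rightOp_apply, conjUnitary_apply, leftOp_apply]
  group

theorem star_leftOp (g : G) : star (leftOp g) = leftOp g⁻¹ := by
  rw [ContinuousLinearMap.star_eq_adjoint, eq_comm, ContinuousLinearMap.eq_adjoint_iff]
  intro x y
  have h : leftOp g (leftOp g⁻¹ x) = x := by
    ext h
    simp [leftOp_apply]
  conv_rhs => rw [← h]
  exact ((leftRegular G g).inner_map_map _ _).symm

theorem leftOp_mul_rightOp (g h : G) : leftOp g * rightOp h = rightOp h * leftOp g := by
  ext f k
  simp [leftOp_apply, rightOp_apply, mul_assoc]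

theorem leftOp_mem (g : G) : leftOp g ∈ groupVN G := by
  refine (StarSubalgebra.mem_centralizer_iff ℂ).2 fun y hy => ⟨?_, ?_⟩
  · exact (((StarSubalgebra.mem_centralizer_iff ℂ).1 hy _ ⟨g, rfl⟩).1).symm
  · exact (((StarSubalgebra.mem_centralizer_iff ℂ).1 (star_mem hy) _ ⟨g, rfl⟩).1).symm

theorem apply_rightOp {x : ℓ²(G, ℂ) →L[ℂ] ℓ²(G, ℂ)} (hx : x ∈ groupVN G) (g : G)
    (f : ℓ²(G, ℂ)) : x (rightOp g f) = rightOp g (x f) := by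
  refine (DFunLike.congr_fun ((StarSubalgebra.mem_centralizer_iff ℂ).1 hx (rightOp g) ?_).1 f).symm
  refine (StarSubalgebra.mem_centralizer_iff ℂ).2 ?_
  rintro _ ⟨h, rfl⟩
  refine ⟨leftOp_mul_rightOp h g, ?_⟩
  change star (leftOp h) * _ = _ * star (leftOp h)
  rw [star_leftOp, leftOp_mul_rightOp]

theorem apply_delta {x : ℓ²(G, ℂ) →L[ℂ] ℓ²(G, ℂ)} (hx : x ∈ groupVN G) (g : G) :
    x (delta g) = rightOp g (x (delta 1)) := by
  rw [← apply_rightOp hx, rightOp_delta, one_mul]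

theorem ext_of_delta_one {x y : ℓ²(G, ℂ) →L[ℂ] ℓ²(G, ℂ)} (hx : x ∈ groupVN G)
    (hy : y ∈ groupVN G) (h : x (delta 1) = y (delta 1)) : x = y :=
  ext_of_delta fun g => by rw [apply_delta hx, apply_delta hy, h]

theorem star_apply_delta_one {x : ℓ²(G, ℂ) →L[ℂ] ℓ²(G, ℂ)} (hx : x ∈ groupVN G) (g : G) :
    star x (delta 1) g = star (x (delta 1) g⁻¹) := by
  rw [← inner_delta, ContinuousLinearMap.star_eq_adjoint, ContinuousLinearMap.adjoint_inner_right,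
    ← inner_conj_symm, inner_delta, apply_delta hx, rightOp_apply, one_mul]
  rfl

theorem groupTrace_apply (x : (groupVN G).toStarSubalgebra) :
    groupTrace G x = (x : ℓ²(G, ℂ) →L[ℂ] ℓ²(G, ℂ)) (delta 1) 1 :=
  inner_delta _ _

/-- The sum is symmetric under `g ↦ g⁻¹`, which yields the trace property. -/
theorem groupTrace_mul (x y : (groupVN G).toStarSubalgebra) :
    groupTrace G (x * y) = ∑' g, (x : ℓ²(G, ℂ) →L[ℂ] ℓ²(G, ℂ)) (delta 1) g⁻¹ *
      (y : ℓ²(G, ℂ) →L[ℂ] ℓ²(G, ℂ)) (delta 1) g := by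
  have h : groupTrace G (x * y) = inner ℂ (star (x : ℓ²(G, ℂ) →L[ℂ] ℓ²(G, ℂ)) (delta 1))
      ((y : ℓ²(G, ℂ) →L[ℂ] ℓ²(G, ℂ)) (delta 1)) := by
    rw [ContinuousLinearMap.star_eq_adjoint, ContinuousLinearMap.adjoint_inner_left]
    rfl
  rw [h, lp.inner_eq_tsum]
  congr 1 with g
  rw [star_apply_delta_one x.2]
  simp [mul_comm]

theorem groupTrace_star_mul_self (x : (groupVN G).toStarSubalgebra) :
    groupTrace G (star x * x) =
      ((‖(x : ℓ²(G, ℂ) →L[ℂ] ℓ²(G, ℂ)) (delta 1)‖ ^ 2 : ℝ) : ℂ) := by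
  have h : groupTrace G (star x * x) = inner ℂ ((x : ℓ²(G, ℂ) →L[ℂ] ℓ²(G, ℂ)) (delta 1))
      ((x : ℓ²(G, ℂ) →L[ℂ] ℓ²(G, ℂ)) (delta 1)) := by
    rw [← ContinuousLinearMap.adjoint_inner_right, ← ContinuousLinearMap.star_eq_adjoint]
    rfl
  rw [h, inner_self_eq_norm_sq_to_K]
  simp

theorem twoNorm_groupTrace (x : (groupVN G).toStarSubalgebra) :
    twoNorm (groupTrace G) x = ‖(x : ℓ²(G, ℂ) →L[ℂ] ℓ²(G, ℂ)) (delta 1)‖ := by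
  rw [twoNorm, groupTrace_star_mul_self, Complex.ofReal_re, Real.sqrt_sq (norm_nonneg _)]

theorem isFaithfulNormalTracialState_groupTrace (G : Type u) [Group G] :
    IsFaithfulNormalTracialState (groupVN G) (groupTrace G) where
  map_one := by
    rw [groupTrace_apply]
    exact delta_self 1
  nonneg x := by
    rw [groupTrace_star_mul_self]
    exact Complex.zero_le_real.2 (sq_nonneg _)
  faithful x hx := by
    rw [groupTrace_star_mul_self] at hx
    have h : (x : ℓ²(G, ℂ) →L[ℂ] ℓ²(G, ℂ)) (delta 1) = 0 := by simpa using hx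
    exact Subtype.ext (ext_of_delta_one x.2 (zero_mem _) (by simpa using h))
  tracial x y := by
    rw [groupTrace_mul, groupTrace_mul, ← Equiv.tsum_eq (Equiv.inv G)]
    congr 1 with g
    simp [mul_comm]
  normal := by
    have hs : Summable fun n : ℕ => ‖(if n = 0 then delta (1 : G) else 0)‖ ^ 2 :=
      summable_of_ne_finset_zero (s := {0}) fun n hn => by
        simp [show n ≠ 0 by simpa using hn]
    refine ⟨fun n => if n = 0 then delta 1 else 0, fun n => if n = 0 then delta 1 else 0, hs, hs,
      fun x => ?_⟩
    convert! hasSum_single (f := fun n : ℕ => inner ℂ (if n = 0 then delta (1 : G) else 0)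
      ((x : ℓ²(G, ℂ) →L[ℂ] ℓ²(G, ℂ)) (if n = 0 then delta (1 : G) else 0))) 0
      fun n hn => by simp [hn]

theorem isFactor_groupVN (h : ¬ InnerAmenable G) : IsFactor (groupVN G) := by
  intro x hx hx'
  set ξ := x (delta 1)
  have hinv (g : G) : conjUnitary g ξ = ξ := by
    refine (rightTranslation g).injective ?_
    change rightOp g (conjUnitary g ξ) = rightOp g ξ
    rw [rightOp_conjUnitary, ← apply_delta hx]
    have := DFunLike.congr_fun
      (VonNeumannAlgebra.mem_commutant_iff.1 hx' _ (leftOp_mem g)) (delta 1)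
    simpa [leftOp_delta] using this
  -- Off `e`, the invariant vector `ξ` must vanish, since otherwise normalizing it would give inner
  -- amenability.
  have h₀ : ξ - ξ 1 • delta 1 = 0 := by
    by_contra hne
    refine h (innerAmenable_of_invariant hne ?_ fun g => ?_)
    · change ξ 1 - ξ 1 * delta (1 : G) 1 = 0
      rw [delta_self, mul_one, sub_self]
    · rw [map_sub, map_smul, hinv, conjUnitary_delta_one]
  refine ⟨ξ 1, ext_of_delta_one hx ?_ ?_⟩
  · exact (groupVN G).toStarSubalgebra.smul_mem (one_mem _) _
  · simpa [sub_eq_zero] using h₀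

theorem not_finiteDimensional_groupVN [Infinite G] :
    ¬ FiniteDimensional ℂ (groupVN G).toStarSubalgebra := by
  intro hfin
  let T : (groupVN G).toStarSubalgebra →ₗ[ℂ] ℓ²(G, ℂ) :=
    { toFun := fun x => (x : ℓ²(G, ℂ) →L[ℂ] ℓ²(G, ℂ)) (delta 1)
      map_add' := fun _ _ => rfl
      map_smul' := fun _ _ => rfl }
  let v : G → (groupVN G).toStarSubalgebra := fun g => ⟨leftOp g, leftOp_mem g⟩
  have hv : T ∘ v = delta := by
    ext1 g
    change leftOp g (delta 1) = delta g
    rw [leftOp_delta, mul_one]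
  have hli : LinearIndependent ℂ v := by
    refine LinearIndependent.of_comp T ?_
    rw [hv]
    exact orthonormal_delta.linearIndependent
  exact not_finite_iff_infinite.2 ‹Infinite G› hli.finite

theorem isIIOneFactor_groupVN [Nontrivial G] (h : ¬ InnerAmenable G) :
    IsIIOneFactor (groupVN G) (groupTrace G) :=
  have := infinite_of_not_innerAmenable h
  ⟨isFactor_groupVN h, not_finiteDimensional_groupVN, isFaithfulNormalTracialState_groupTrace G⟩

theorem innerAmenable_of_hasPropertyGamma
    (h : HasPropertyGamma (groupVN G) (groupTrace G)) : InnerAmenable G := by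
  obtain ⟨u, hu, hτ, hlim⟩ := h
  refine innerAmenable_of_forall_exists fun F ε hε => ?_
  have hev : ∀ᶠ n in atTop, ∀ g ∈ F, twoNorm (groupTrace G)
      (u n * ⟨leftOp g, leftOp_mem g⟩ - ⟨leftOp g, leftOp_mem g⟩ * u n) < ε :=
    (Filter.eventually_all_finset F).2 fun g _ => (hlim _).eventually_lt_const hε
  obtain ⟨n, hn⟩ := hev.exists
  -- Unitarity makes `uₙ δ_e` a unit vector, and trace zero makes it vanish at `e`.
  refine ⟨(u n : ℓ²(G, ℂ) →L[ℂ] ℓ²(G, ℂ)) (delta 1), ?_, ?_, fun g hg => ?_⟩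
  · rw [← twoNorm_groupTrace, twoNorm, (Unitary.mem_iff.1 (hu n)).1,
      (isFaithfulNormalTracialState_groupTrace G).map_one]
    simp
  · rw [← groupTrace_apply, hτ]
  · refine lt_of_eq_of_lt ?_ (hn g hg)
    rw [twoNorm_groupTrace, ← norm_rightOp g, map_sub, rightOp_conjUnitary, ← apply_delta (u n).2,
      norm_sub_rev]
    congr 1
    simp [leftOp_delta]

end GroupVN

end GroupVN
end

/-- `Γ 0` and `Γ 1` are the two groups, `φ 0` and `φ 1` the embeddings of the common subgroup `Λ`,
and `Monoid.PushoutI φ` is the amalgamated free product `Γ 0 *_Λ Γ 1`. -/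
theorem mainTheorem12 {Γ : Fin 2 → Type*} {Λ : Type*} [∀ i, Group (Γ i)] [Group Λ]
    (φ : ∀ i, Λ →* Γ i) (hφ : ∀ i, Function.Injective (φ i))
    (h₁ : 2 ≤ ENat.card (Γ 0 ⧸ (φ 0).range)) (h₂ : 3 ≤ ENat.card (Γ 1 ⧸ (φ 1).range))
    (m : ℕ) (g : Fin m → Monoid.PushoutI φ)
    (hg : ⨅ i, (Monoid.PushoutI.base φ).range.map (MulAut.conj (g i)).toMonoidHom = ⊥) :
    GroupVN.IsIIOneFactor (GroupVN.groupVN (Monoid.PushoutI φ))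
        (GroupVN.groupTrace (Monoid.PushoutI φ)) ∧
      ¬ GroupVN.HasPropertyGamma (GroupVN.groupVN (Monoid.PushoutI φ))
        (GroupVN.groupTrace (Monoid.PushoutI φ)) ∧
      ¬ GroupVN.InnerAmenable (Monoid.PushoutI φ) := by
  have hG := GroupVN.not_innerAmenable_pushoutI φ hφ h₁ h₂ m g hg
  obtain ⟨a, ha⟩ := Subgroup.exists_notMem_of_two_le_card h₁
  have : Nontrivial (Monoid.PushoutI φ) :=
    ⟨Monoid.PushoutI.of 0 a, 1, fun h => ha (by
      rw [Monoid.PushoutI.of_injective hφ 0 (h.trans (map_one _).symm)]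
      exact one_mem _)⟩
  exact ⟨GroupVN.isIIOneFactor_groupVN hG,
    fun h => hG (GroupVN.innerAmenable_of_hasPropertyGamma h), hG⟩
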